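/- Let $A$ be a closed densely defined linear operator on a complex Hilbert space $H$ with $\mathrm{i}\mathbb{R}\subset\varrho(A)$, and let $B$ be a symmetric linear operator on $H$ with $\mathcal{D}(A^*)\subset\mathcal{D}(B)$. (Then $-\mathrm{i}t\in\varrho(A^*)$ for all $t\in\mathbb{R}$.) Consider the assertions (i) $\ker B=\{0\}$; (ii) $\bigcap_{t\in\mathbb{R}}\ker\bigl(B(A^*+\mathrm{i}t)^{-1}\bigr)=\{0\}$; (iii) $\overline{\operatorname{span}\{(A-\mathrm{i}t)^{-1}B^*u : t\in\mathbb{R},\ u\in\mathcal{D}(B^*)\}}=H$; (iv) $\ker B\cap\ker(A^*-\lambda)=\{0\}$ for every eigenvalue $\lambda\in\sigma_p(A^*)$. Then (i) $\Rightarrow$ (ii) $\Leftrightarrow$ (iii) $\Rightarrow$ (iv). If, in addition, $A$ has compact resolvent and possesses a complete system of generalised eigenvectors (i.e. the linear span of all the subspaces $\ker(A-\lambda)^n$, $\lambda\in\sigma_p(A)$, $n\ge 1$, is dense in $H$), then also (iii) $\Leftrightarrow$ (iv). -/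

import Mathlib

open scoped LinearPMap

namespace UnbddOp

noncomputable section

variable {H : Type*} [NormedAddCommGroup H] [InnerProductSpace ℂ H]

/-- The kernel of a partially defined operator, as a subspace of the whole space. -/
def ker (T : H →ₗ.[ℂ] H) : Submodule ℂ H :=
  (LinearMap.ker T.toFun).map T.domain.subtype

/-- The operator `T - z` with domain `D(T)`. -/
def subScalar (T : H →ₗ.[ℂ] H) (z : ℂ) : H →ₗ.[ℂ] H where
  domain := T.domain
  toFun := T.toFun - z • T.domain.subtype

/-- `R` is a bounded, everywhere defined, two-sided inverse of the operator `T`. -/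
def IsBoundedInverse (T : H →ₗ.[ℂ] H) (R : H →L[ℂ] H) : Prop :=
  (∀ x : H, ∃ h : R x ∈ T.domain, T ⟨R x, h⟩ = x) ∧ ∀ y : T.domain, R (T y) = y

theorem IsBoundedInverse.unique {T : H →ₗ.[ℂ] H} {R S : H →L[ℂ] H}
    (hR : IsBoundedInverse T R) (hS : IsBoundedInverse T S) : R = S := by
  ext x
  obtain ⟨h, hx⟩ := hS.1 x
  have h2 := hR.2 ⟨S x, h⟩
  rwa [hx] at h2

/-- The resolvent set `ϱ(T)`. -/
def resolventSet (T : H →ₗ.[ℂ] H) : Set ℂ :=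
  {z | ∃ R : H →L[ℂ] H, IsBoundedInverse (subScalar T z) R}

open scoped Classical in
/-- The resolvent `(T - z)⁻¹` for `z ∈ ϱ(T)` (and `0` for other `z`). -/
def resolvent (T : H →ₗ.[ℂ] H) (z : ℂ) : H →L[ℂ] H :=
  if h : ∃ R : H →L[ℂ] H, IsBoundedInverse (subScalar T z) R then h.choose else 0

theorem resolvent_spec {T : H →ₗ.[ℂ] H} {z : ℂ} (hz : z ∈ resolventSet T) :
    IsBoundedInverse (subScalar T z) (resolvent T z) := by
  have h : ∃ R : H →L[ℂ] H, IsBoundedInverse (subScalar T z) R := hz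
  rw [resolvent, dif_pos h]
  exact h.choose_spec

/-- The product `T R` of an operator `T` with a bounded operator `R`,
with domain `{x | R x ∈ D(T)}`. -/
def compBounded (T : H →ₗ.[ℂ] H) (R : H →L[ℂ] H) : H →ₗ.[ℂ] H where
  domain := T.domain.comap (R : H →ₗ[ℂ] H)
  toFun := T.toFun ∘ₗ (R : H →ₗ[ℂ] H).restrict (fun _ hx => hx)

/-- The point spectrum (set of eigenvalues) `σ_p(T)`. -/
def pointSpectrum (T : H →ₗ.[ℂ] H) : Set ℂ :=
  {z | ker (subScalar T z) ≠ ⊥}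

/-- The kernel of the power `T ^ n`, where `D(T ^ (n + 1)) = {x ∈ D(T) | T x ∈ D(T ^ n)}`. -/
def kerPow (T : H →ₗ.[ℂ] H) : ℕ → Submodule ℂ H
  | 0 => ⊥
  | n + 1 => ((kerPow T n).comap T.toFun).map T.domain.subtype

/-- `T` has compact resolvent: `(T - z)⁻¹` is compact for some (equivalently, for every)
`z ∈ ϱ(T)`. -/
def HasCompactResolvent (T : H →ₗ.[ℂ] H) : Prop :=
  ∃ z ∈ resolventSet T, IsCompactOperator (resolvent T z)

/-- The system of generalised eigenvectors of `T`, that is, of the nonzero elements of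
`ker ((T - z) ^ n)` with `z ∈ σ_p(T)` and `n ≥ 1`, is complete: its linear span is dense. -/
def HasCompleteGeneralisedEigenvectors (T : H →ₗ.[ℂ] H) : Prop :=
  (Submodule.span ℂ {x : H | x ≠ 0 ∧ ∃ z ∈ pointSpectrum T, ∃ n : ℕ,
    x ∈ kerPow (subScalar T z) n}).topologicalClosure = ⊤

/-- The kernel condition `⋂ₜ ker (B (A* + i t)⁻¹) = {0}`, with `t` ranging over the reals. -/
def KernelCondition [CompleteSpace H] (A B : H →ₗ.[ℂ] H) : Prop :=
  ⨅ t : ℝ, ker (compBounded B (resolvent A† (-(Complex.I * t)))) = ⊥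

/-- The linear span of the vectors `(A - i t)⁻¹ B* u`, with `t` real and `u ∈ D(B*)`,
is dense. -/
def DenseSpanCondition [CompleteSpace H] (A B : H →ₗ.[ℂ] H) : Prop :=
  (Submodule.span ℂ {x : H | ∃ (t : ℝ) (u : B†.domain),
    x = resolvent A (Complex.I * t) (B† u)}).topologicalClosure = ⊤

/-- For every eigenvalue `z` of `A*`, `ker B ∩ ker (A* - z) = {0}`. -/
def NoEigenvectorInKernel [CompleteSpace H] (A B : H →ₗ.[ℂ] H) : Prop :=
  ∀ z ∈ pointSpectrum A†, ker B ⊓ ker (subScalar A† z) = ⊥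

end

end UnbddOp

open scoped InnerProductSpace

/-! Since `(A* + it)⁻¹` is the adjoint of `(A - it)⁻¹`, and a vector of `D(B)` lies in `ker B` iff
it is orthogonal to the range of `B*`, the intersection in (ii) is exactly the orthogonal complement
`N` of the span in (iii) (`iInf_ker_compBounded_eq`). An eigenvector of `A*` in `ker B` is only
rescaled by the resolvents, so it lies in `N`; this gives (iv).

For the converse put `K = (A*)⁻¹`, which is compact by Schauder. `N` is closed and `K`-invariant
(`adjoint_resolvent_mem_orthogonal`), and an eigenvector of `K` in `N` with nonzero eigenvalue would
be an eigenvector of `A*` in `ker B`, excluded by (iv). By the Fredholm alternative every `1 - aK`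
maps `N` onto `N`, which forces `N` to be orthogonal to all root subspaces of `A`
(`inner_eq_zero_of_mem_kerPow`). Completeness then gives `N = 0`. -/

/-- Schauder's theorem in a Hilbert space: the adjoint of a compact operator is compact. -/
theorem IsCompactOperator.adjoint {H : Type*} [NormedAddCommGroup H] [InnerProductSpace ℂ H]
    [CompleteSpace H] {T : H →L[ℂ] H} (hT : IsCompactOperator T) :
    IsCompactOperator (ContinuousLinearMap.adjoint T) := by
  set K := ContinuousLinearMap.adjoint T
  have hTK : IsCompactOperator (T ∘L K) := hT.comp_clm K
  refine (isCompactOperator_iff_isCompact_closure_image_closedBall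
    (K : H →ₗ[ℂ] H) one_pos).2 (TotallyBounded.isCompact_of_isClosed ?_ isClosed_closure)
  refine TotallyBounded.closure (Metric.totallyBounded_iff.2 fun ε hε => ?_)
  have htb : TotallyBounded ((T ∘L K) '' Metric.closedBall 0 1) :=
    (hTK.isCompact_closure_image_closedBall (f := ((T ∘L K : H →L[ℂ] H) : H →ₗ[ℂ] H))
      1).totallyBounded.subset subset_closure
  -- `‖K p‖² ≤ ‖p‖ ‖T K p‖`, and differences `p` of points of the unit ball have norm at most 2, so
  -- an `ε² / 2`-net for the image under `T K` yields an `ε`-net for the image under `K`.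
  obtain ⟨t, hts, htf, hcov⟩ :=
    Metric.finite_approx_of_totallyBounded htb (ε ^ 2 / 2) (by positivity)
  have hts' : ∀ y ∈ t, ∃ x ∈ Metric.closedBall (0 : H) 1, T (K x) = y := hts
  choose! g hg hgt using hts'
  refine ⟨(fun y => K (g y)) '' t, htf.image _, ?_⟩
  rintro _ ⟨x, hx, rfl⟩
  obtain ⟨y, hy, hxy⟩ := Set.mem_iUnion₂.1 (hcov ⟨x, hx, rfl⟩)
  refine Set.mem_iUnion₂.2 ⟨K (g y), ⟨y, hy, rfl⟩, ?_⟩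
  have hxy' : ‖T (K (x - g y))‖ < ε ^ 2 / 2 := by
    rw [map_sub, map_sub, hgt y hy, ← dist_eq_norm]
    exact hxy
  change dist (K x) (K (g y)) < ε
  rw [dist_eq_norm, ← map_sub]
  have hp : ‖x - g y‖ ≤ 2 := by
    have h₁ := mem_closedBall_zero_iff.1 hx
    have h₂ := mem_closedBall_zero_iff.1 (hg y hy)
    linarith [norm_sub_le x (g y)]
  have hsq : ‖K (x - g y)‖ ^ 2 ≤ ‖x - g y‖ * ‖T (K (x - g y))‖ := by
    have h : ⟪K (x - g y), K (x - g y)⟫_ℂ = ⟪x - g y, T (K (x - g y))⟫_ℂ :=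
      ContinuousLinearMap.adjoint_inner_left T _ _
    rw [inner_self_eq_norm_sq_to_K] at h
    have h' := norm_inner_le_norm (𝕜 := ℂ) (x - g y) (T (K (x - g y)))
    rw [← h] at h'
    simpa using h'
  refine lt_of_pow_lt_pow_left₀ 2 hε.le (hsq.trans_lt ?_)
  nlinarith [norm_nonneg (T (K (x - g y)))]

namespace UnbddOp

variable {H : Type*} [NormedAddCommGroup H] [InnerProductSpace ℂ H] {T : H →ₗ.[ℂ] H} {z w : ℂ}

/-! ### Kernels and resolvents of partially defined operators -/

theorem mem_ker_iff {x : H} : x ∈ ker T ↔ ∃ h : x ∈ T.domain, T ⟨x, h⟩ = 0 := by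
  constructor
  · rintro ⟨y, hy, rfl⟩
    exact ⟨y.2, hy⟩
  · rintro ⟨h, hx⟩
    exact ⟨⟨x, h⟩, hx, rfl⟩

theorem mem_ker_subScalar_iff {x : H} :
    x ∈ ker (subScalar T z) ↔ ∃ h : x ∈ T.domain, T ⟨x, h⟩ = z • x := by
  refine mem_ker_iff.trans (exists_congr fun h => ?_)
  exact sub_eq_zero (a := T ⟨x, h⟩)

theorem mem_ker_compBounded_iff {R : H →L[ℂ] H} {x : H} :
    x ∈ ker (compBounded T R) ↔ R x ∈ ker T := by
  rw [mem_ker_iff, mem_ker_iff]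
  rfl

theorem resolvent_mem_domain (hz : z ∈ resolventSet T) (x : H) : resolvent T z x ∈ T.domain :=
  ((resolvent_spec hz).1 x).1

theorem apply_resolvent (hz : z ∈ resolventSet T) (x : H) :
    T ⟨resolvent T z x, resolvent_mem_domain hz x⟩ = x + z • resolvent T z x :=
  sub_eq_iff_eq_add.1 ((resolvent_spec hz).1 x).2

theorem resolvent_apply (hz : z ∈ resolventSet T) (y : T.domain) :
    resolvent T z (T y) = y + z • resolvent T z y := by
  have h : resolvent T z (T y - z • (y : H)) = y := (resolvent_spec hz).2 y
  rwa [map_sub, map_smul, sub_eq_iff_eq_add] at h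

theorem resolvent_injective (hz : z ∈ resolventSet T) {x : H} (hx : resolvent T z x = 0) :
    x = 0 := by
  have h := apply_resolvent hz x
  have h0 : (⟨resolvent T z x, resolvent_mem_domain hz x⟩ : T.domain) = 0 := Subtype.ext hx
  rw [h0, T.map_zero, hx, smul_zero, add_zero] at h
  exact h.symm

/-- The resolvent identity. -/
theorem resolvent_eq_add (hz : z ∈ resolventSet T) (hw : w ∈ resolventSet T) :
    resolvent T z = resolvent T w + (z - w) • (resolvent T w * resolvent T z) := by
  ext x
  have h := resolvent_apply hw ⟨resolvent T z x, resolvent_mem_domain hz x⟩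
  rw [apply_resolvent hz, map_add, map_smul] at h
  change _ = resolvent T w x + (z - w) • resolvent T w (resolvent T z x)
  rw [sub_smul, ← add_sub_assoc, h, add_sub_cancel_right]

/-- The resolvent identity, used in both orders, makes `1 + (z - w) S` a two-sided inverse of `1 -
(z - w) R`. This form transfers compactness from `w` to `z` and shows norm continuity in `z`. -/
theorem resolvent_eq_mul_inverse (hz : z ∈ resolventSet T) (hw : w ∈ resolventSet T) :
    resolvent T z = resolvent T w * Ring.inverse (1 - (z - w) • resolvent T w) := by
  have h₁ := resolvent_eq_add hz hw
  have h₂ := resolvent_eq_add hw hz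
  set R := resolvent T w
  set S := resolvent T z
  have hu₁ : (1 - (z - w) • R) * (1 + (z - w) • S) = 1 := by
    have h : (1 - (z - w) • R) * (1 + (z - w) • S)
        = 1 + (z - w) • (S - (R + (z - w) • (R * S))) := by
      simp only [sub_mul, mul_add, one_mul, mul_one, smul_mul_assoc, mul_smul_comm]
      module
    rw [h, ← h₁, sub_self, smul_zero, add_zero]
  have hu₂ : (1 + (z - w) • S) * (1 - (z - w) • R) = 1 := by
    have h : (1 + (z - w) • S) * (1 - (z - w) • R)
        = 1 - (z - w) • (R - (S + (w - z) • (S * R))) := by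
      simp only [mul_sub, add_mul, one_mul, mul_one, smul_mul_assoc, mul_smul_comm]
      module
    rw [h, ← h₂, sub_self, smul_zero, sub_zero]
  have hinv : Ring.inverse (1 - (z - w) • R) = 1 + (z - w) • S :=
    Ring.inverse_unit (⟨_, _, hu₁, hu₂⟩ : (H →L[ℂ] H)ˣ)
  rw [hinv, mul_add, mul_one, mul_smul_comm]
  exact h₁

theorem isCompactOperator_resolvent (hz : z ∈ resolventSet T) (hw : w ∈ resolventSet T)
    (hc : IsCompactOperator (resolvent T w)) : IsCompactOperator (resolvent T z) := by
  rw [resolvent_eq_mul_inverse hz hw]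
  exact hc.comp_clm _

/-! ### Adjoints of resolvents -/

variable [CompleteSpace H]

/-- The adjoint of the resolvent inverts `T* - z̄`. -/
theorem isBoundedInverse_adjoint (hT : Dense (T.domain : Set H)) (hz : z ∈ resolventSet T) :
    IsBoundedInverse (subScalar T† (starRingEnd ℂ z))
      (ContinuousLinearMap.adjoint (resolvent T z)) := by
  -- This exhibits `x + z̄ R* x` as the value of `T*` at `R* x`.
  have key (x : H) (y : T.domain) :
      ⟪x + starRingEnd ℂ z • ContinuousLinearMap.adjoint (resolvent T z) x, y⟫_ℂ =
        ⟪ContinuousLinearMap.adjoint (resolvent T z) x, T y⟫_ℂ := by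
    rw [ContinuousLinearMap.adjoint_inner_left, resolvent_apply hz, inner_add_left,
      inner_smul_left, ContinuousLinearMap.adjoint_inner_left, inner_add_right, inner_smul_right,
      Complex.conj_conj]
  refine ⟨fun x => ?_, fun y => ?_⟩
  · have hx := LinearPMap.mem_adjoint_domain_of_exists _ ⟨_, key x⟩
    exact ⟨hx, sub_eq_iff_eq_add.2 (LinearPMap.adjoint_apply_eq hT ⟨_, hx⟩ (key x))⟩
  · refine ext_inner_right ℂ fun v => ?_
    have hy := LinearPMap.adjoint_isFormalAdjoint hT y
      ⟨resolvent T z v, resolvent_mem_domain hz v⟩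
    rw [apply_resolvent hz, inner_add_right, inner_smul_right] at hy
    rw [ContinuousLinearMap.adjoint_inner_left]
    change ⟪T† y - starRingEnd ℂ z • (y : H), _⟫_ℂ = _
    rw [inner_sub_left, inner_smul_left, Complex.conj_conj]
    exact sub_eq_iff_eq_add.2 hy

theorem conj_mem_resolventSet_adjoint (hT : Dense (T.domain : Set H)) (hz : z ∈ resolventSet T) :
    starRingEnd ℂ z ∈ resolventSet T† :=
  ⟨_, isBoundedInverse_adjoint hT hz⟩

theorem resolvent_adjoint (hT : Dense (T.domain : Set H)) (hz : z ∈ resolventSet T) :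
    resolvent T† (starRingEnd ℂ z) = ContinuousLinearMap.adjoint (resolvent T z) :=
  (resolvent_spec (conj_mem_resolventSet_adjoint hT hz)).unique (isBoundedInverse_adjoint hT hz)

/-- `D(T*)` contains the range of the adjoint of the resolvent, whose orthogonal complement is the
kernel of the resolvent, hence zero. -/
theorem dense_adjoint_domain (hT : Dense (T.domain : Set H)) (hz : z ∈ resolventSet T) :
    Dense (T†.domain : Set H) := by
  rw [Submodule.dense_iff_topologicalClosure_eq_top, Submodule.topologicalClosure_eq_top_iff,
    Submodule.eq_bot_iff]
  intro x hx
  refine resolvent_injective hz (ext_inner_left ℂ fun v => ?_)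
  rw [inner_zero_right, ← ContinuousLinearMap.adjoint_inner_left, ← resolvent_adjoint hT hz]
  exact (Submodule.mem_orthogonal _ _).1 hx _
    (resolvent_mem_domain (conj_mem_resolventSet_adjoint hT hz) v)

theorem conj_I_mul (t : ℝ) : starRingEnd ℂ (Complex.I * t) = -(Complex.I * t) := by simp

/-- For densely defined `B`, the vectors `y` of `D(B)` annihilating the range of `B*` are those
of `ker B`. -/
theorem mem_ker_iff_inner_adjoint {B : H →ₗ.[ℂ] H} (hB : Dense (B.domain : Set H))
    (hB' : Dense (B†.domain : Set H)) {y : H} (hy : y ∈ B.domain) :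
    y ∈ ker B ↔ ∀ u : B†.domain, ⟪B† u, y⟫_ℂ = 0 := by
  have h (u : B†.domain) : ⟪B† u, y⟫_ℂ = ⟪(u : H), B ⟨y, hy⟩⟫_ℂ :=
    LinearPMap.adjoint_isFormalAdjoint hB u ⟨y, hy⟩
  simp only [h, mem_ker_iff, hy, exists_true_left]
  exact ⟨fun h0 u => by rw [h0, inner_zero_right],
    fun h0 => hB'.eq_zero_of_inner_right ℂ fun v hv => h0 ⟨v, hv⟩⟩

/-! ### The orthogonal complement of the span -/

/-- The vectors `(A - i t)⁻¹ B* u`. -/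
def resolventRange (A B : H →ₗ.[ℂ] H) : Set H :=
  {x : H | ∃ (t : ℝ) (u : B†.domain), x = resolvent A (Complex.I * t) (B† u)}

variable {A B : H →ₗ.[ℂ] H}

theorem mem_orthogonal_resolventRange {x : H} :
    x ∈ (Submodule.span ℂ (resolventRange A B))ᗮ ↔
      ∀ (t : ℝ) (u : B†.domain), ⟪resolvent A (Complex.I * t) (B† u), x⟫_ℂ = 0 := by
  rw [Submodule.mem_orthogonal]
  refine ⟨fun h t u => h _ (Submodule.subset_span ⟨t, u, rfl⟩), fun h y hy => ?_⟩
  induction hy using Submodule.span_induction with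
  | mem y hy =>
    obtain ⟨t, u, rfl⟩ := hy
    exact h t u
  | zero => exact inner_zero_left _
  | add y z _ _ hy hz => rw [inner_add_left, hy, hz, add_zero]
  | smul a y _ hy => rw [inner_smul_left, hy, mul_zero]

theorem denseSpanCondition_iff :
    DenseSpanCondition A B ↔ (Submodule.span ℂ (resolventRange A B))ᗮ = ⊥ :=
  Submodule.topologicalClosure_eq_top_iff

theorem mem_ker_compBounded_resolvent_iff (hA : Dense (A.domain : Set H))
    (hz : z ∈ resolventSet A) (hB : Dense (B.domain : Set H)) (hB' : Dense (B†.domain : Set H))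
    (hAB : A†.domain ≤ B.domain) {x : H} :
    x ∈ ker (compBounded B (resolvent A† (starRingEnd ℂ z))) ↔
      ∀ u : B†.domain, ⟪resolvent A z (B† u), x⟫_ℂ = 0 := by
  rw [mem_ker_compBounded_iff, mem_ker_iff_inner_adjoint hB hB'
    (hAB (resolvent_mem_domain (conj_mem_resolventSet_adjoint hA hz) x)), resolvent_adjoint hA hz]
  simp only [ContinuousLinearMap.adjoint_inner_right]

/-- The intersection of the kernels is the orthogonal complement of the span. -/
theorem iInf_ker_compBounded_eq (hA : Dense (A.domain : Set H))
    (hres : ∀ t : ℝ, Complex.I * t ∈ resolventSet A) (hB : Dense (B.domain : Set H))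
    (hB' : Dense (B†.domain : Set H)) (hAB : A†.domain ≤ B.domain) :
    ⨅ t : ℝ, ker (compBounded B (resolvent A† (-(Complex.I * t)))) =
      (Submodule.span ℂ (resolventRange A B))ᗮ := by
  ext x
  rw [Submodule.mem_iInf, mem_orthogonal_resolventRange]
  refine forall_congr' fun t => ?_
  rw [← conj_I_mul, mem_ker_compBounded_resolvent_iff hA (hres t) hB hB' hAB]

omit [CompleteSpace H] in
-- From `T x = w x` follows `(w - z) (T - z)⁻¹ x = x`; if `w = z`, this gives `x = 0`.
theorem mem_ker_compBounded_resolvent_of_eigenvector (hz : z ∈ resolventSet T) {x : H}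
    (hx : x ∈ ker B ⊓ ker (subScalar T w)) : x ∈ ker (compBounded B (resolvent T z)) := by
  obtain ⟨hxB, hxT⟩ := hx
  obtain ⟨hx, hTx⟩ := mem_ker_subScalar_iff.1 hxT
  have h := resolvent_apply hz ⟨x, hx⟩
  rw [hTx, map_smul, ← sub_eq_iff_eq_add, ← sub_smul] at h
  rw [mem_ker_compBounded_iff]
  by_cases hwz : w - z = 0
  · have hx0 : x = 0 := by simpa [hwz] using h.symm
    rw [hx0, map_zero]
    exact zero_mem _
  · rw [← inv_smul_smul₀ hwz (resolvent T z x), h]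
    exact Submodule.smul_mem _ _ hxB

/-- The orthogonal complement of the span is invariant under `(A*)⁻¹`. -/
theorem adjoint_resolvent_mem_orthogonal (hres : ∀ t : ℝ, Complex.I * t ∈ resolventSet A) {x : H}
    (hx : x ∈ (Submodule.span ℂ (resolventRange A B))ᗮ) :
    ContinuousLinearMap.adjoint (resolvent A 0) x ∈
      (Submodule.span ℂ (resolventRange A B))ᗮ := by
  have h0 : (0 : ℂ) ∈ resolventSet A := by simpa using hres 0
  rw [mem_orthogonal_resolventRange] at hx ⊢
  intro t u
  rw [ContinuousLinearMap.adjoint_inner_right]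
  -- By the resolvent identity, `it A⁻¹ (A - it)⁻¹` is a difference of two resolvents, and `x`
  -- annihilates both terms; divide by the nonzero factor.
  have hne (t : ℝ) (ht : t ≠ 0) :
      ⟪resolvent A 0 (resolvent A (Complex.I * t) (B† u)), x⟫_ℂ = 0 := by
    have hx0 := hx 0 u
    rw [Complex.ofReal_zero, mul_zero] at hx0
    have hR : ⟪resolvent A (Complex.I * t) (B† u), x⟫_ℂ =
        ⟪resolvent A 0 (B† u) + (Complex.I * t - 0) •
          resolvent A 0 (resolvent A (Complex.I * t) (B† u)), x⟫_ℂ :=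
      congrArg (fun S : H →L[ℂ] H => ⟪S (B† u), x⟫_ℂ) (resolvent_eq_add (hres t) h0)
    rw [inner_add_left, inner_smul_left, hx t u, hx0, zero_add, sub_zero] at hR
    exact (mul_eq_zero.1 hR.symm).resolve_left (by simpa using ht)
  rcases ne_or_eq t 0 with ht | rfl
  · exact hne t ht
  -- At `t = 0` that factor vanishes, so the claim is obtained as a limit through `t ≠ 0`.
  have hcont : ContinuousAt (fun t : ℝ => resolvent A (Complex.I * t)) 0 := by
    have heq : (fun t : ℝ => resolvent A (Complex.I * t)) = fun t : ℝ =>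
        resolvent A 0 * Ring.inverse (1 - (Complex.I * t - 0) • resolvent A 0) :=
      funext fun t => resolvent_eq_mul_inverse (hres t) h0
    rw [heq]
    refine continuousAt_const.mul (ContinuousAt.comp
      (g := Ring.inverse) (f := fun t : ℝ => 1 - (Complex.I * t - 0) • resolvent A 0) ?_ ?_)
    · simpa using NormedRing.inverse_continuousAt (1 : (H →L[ℂ] H)ˣ)
    · fun_prop
  have hlim : ContinuousAt (fun t : ℝ =>
      ⟪resolvent A 0 (resolvent A (Complex.I * t) (B† u)), x⟫_ℂ) 0 := by
    have h : ContinuousAt (fun t : ℝ =>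
        resolvent A 0 (resolvent A (Complex.I * t) (B† u))) 0 :=
      (resolvent A 0).continuous.continuousAt.comp (hcont.clm_apply continuousAt_const)
    exact Filter.Tendsto.inner h tendsto_const_nhds
  refine tendsto_nhds_unique
    (hlim.tendsto.mono_left (nhdsWithin_le_nhds (s := ({0}ᶜ : Set ℝ)))) ?_
  refine tendsto_const_nhds.congr' ?_
  filter_upwards [self_mem_nhdsWithin] with s hs using (hne s hs).symm

/-! ### Compactness and root subspaces -/

/-- If `K` is compact on the closed invariant subspace `N` and has no eigenvector there, then
`1 - a K` maps `N` onto itself. -/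
theorem exists_sub_smul_eq_of_no_eigenvector {K : H →L[ℂ] H} (hK : IsCompactOperator K)
    {N : Submodule ℂ H} (hN : IsClosed (N : Set H)) (hinv : ∀ x ∈ N, K x ∈ N)
    (hno : ∀ x ∈ N, ∀ μ : ℂ, μ ≠ 0 → K x = μ • x → x = 0) (a : ℂ) {x : H} (hx : x ∈ N) :
    ∃ y ∈ N, x = y - a • K y := by
  by_cases ha : a = 0
  · exact ⟨x, hx, by simp [ha]⟩
  have : CompleteSpace N := hN.completeSpace_coe
  let S : N →L[ℂ] N := (K.comp N.subtypeL).codRestrict N fun x => hinv x x.2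
  have hS : IsCompactOperator S := (hK.comp_clm N.subtypeL).codRestrict _ hN
  -- Fredholm alternative for the restriction of `K` to `N`, at the point `a⁻¹`.
  rcases hS.hasEigenvalue_or_mem_resolventSet (inv_ne_zero ha) with h | h
  · obtain ⟨v, hv⟩ := h.exists_hasEigenvector
    refine absurd (Subtype.ext (hno v v.2 a⁻¹ (inv_ne_zero ha) ?_)) hv.2
    exact congrArg Subtype.val hv.apply_eq_smul
  · rw [spectrum.mem_resolventSet_iff, ContinuousLinearMap.isUnit_iff_bijective] at h
    obtain ⟨y, hy⟩ := h.2 (a⁻¹ • ⟨x, hx⟩)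
    refine ⟨y, y.2, ?_⟩
    have hy' : a⁻¹ • (y : H) - K y = a⁻¹ • x := congrArg Subtype.val hy
    rw [← smul_inv_smul₀ ha x, ← hy', smul_sub, smul_inv_smul₀ ha]

/-- If `(T*)⁻¹` leaves `N` invariant and `1 - z̄ (T*)⁻¹` maps `N` onto itself, then `N` is
orthogonal to the root subspaces of `T` at `z`. -/
theorem inner_eq_zero_of_mem_kerPow (h0 : (0 : ℂ) ∈ resolventSet T) {N : Submodule ℂ H}
    (hinv : ∀ x ∈ N, ContinuousLinearMap.adjoint (resolvent T 0) x ∈ N)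
    (hsurj : ∀ x ∈ N, ∃ y ∈ N,
      x = y - starRingEnd ℂ z • ContinuousLinearMap.adjoint (resolvent T 0) y) (n : ℕ) :
    ∀ y ∈ kerPow (subScalar T z) n, ∀ x ∈ N, ⟪x, y⟫_ℂ = 0 := by
  induction n with
  | zero =>
    rintro y hy x -
    rw [(Submodule.mem_bot ℂ).1 hy, inner_zero_right]
  | succ n ih =>
    rintro _ ⟨y, hy, rfl⟩ x hx
    obtain ⟨x, hx', rfl⟩ := hsurj x hx
    let y : T.domain := y
    have hw : T y - z • (y : H) ∈ kerPow (subScalar T z) n := hy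
    -- With `K = (T*)⁻¹`, `⟪x - z̄ K x, y⟫ = ⟪x, T⁻¹ (T - z) y⟫ = ⟪K x, (T - z) y⟫`, and `K x` stays
    -- in `N`.
    have h := ih _ hw _ (hinv x hx')
    have hy0 : resolvent T 0 (T y) = y := by
      rw [resolvent_apply h0, zero_smul, add_zero]
    rw [ContinuousLinearMap.adjoint_inner_left, map_sub, map_smul, hy0, inner_sub_right,
      inner_smul_right] at h
    change ⟪_, (y : H)⟫_ℂ = 0
    rwa [inner_sub_left, inner_smul_left, Complex.conj_conj,
      ContinuousLinearMap.adjoint_inner_left]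

theorem denseSpanCondition_of_noEigenvectorInKernel (hA : Dense (A.domain : Set H))
    (hres : ∀ t : ℝ, Complex.I * t ∈ resolventSet A) (hB : Dense (B.domain : Set H))
    (hB' : Dense (B†.domain : Set H)) (hAB : A†.domain ≤ B.domain)
    (hc : HasCompactResolvent A) (hg : HasCompleteGeneralisedEigenvectors A)
    (hno : NoEigenvectorInKernel A B) : DenseSpanCondition A B := by
  have h0 : (0 : ℂ) ∈ resolventSet A := by simpa using hres 0
  obtain ⟨w, hw, hwc⟩ := hc
  have hK := (isCompactOperator_resolvent h0 hw hwc).adjoint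
  rw [denseSpanCondition_iff]
  set N := (Submodule.span ℂ (resolventRange A B))ᗮ
  have hinv : ∀ x ∈ N, ContinuousLinearMap.adjoint (resolvent A 0) x ∈ N :=
    fun x hx => adjoint_resolvent_mem_orthogonal hres hx
  have hadj0 : (0 : ℂ) ∈ resolventSet A† := by
    simpa using conj_mem_resolventSet_adjoint hA h0
  have hR : ContinuousLinearMap.adjoint (resolvent A 0) = resolvent A† 0 := by
    simpa using (resolvent_adjoint hA h0).symm
  have heig : ∀ x ∈ N, ∀ μ : ℂ, μ ≠ 0 →
      ContinuousLinearMap.adjoint (resolvent A 0) x = μ • x → x = 0 := by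
    intro x hx μ hμ hxμ
    have hBx : x ∈ ker B := by
      -- The condition at `t = 0` says that `(A*)⁻¹ x = μ x` lies in `ker B`.
      have h := (mem_ker_compBounded_resolvent_iff hA h0 hB hB' hAB (x := x)).2 fun u => by
        simpa using mem_orthogonal_resolventRange.1 hx 0 u
      rw [mem_ker_compBounded_iff, resolvent_adjoint hA h0, hxμ] at h
      simpa [smul_smul, hμ] using Submodule.smul_mem _ μ⁻¹ h
    have hAx : x ∈ ker (subScalar A† μ⁻¹) := by
      rw [hR] at hxμ
      have hxe : x = μ⁻¹ • resolvent A† 0 x := by rw [hxμ, inv_smul_smul₀ hμ]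
      have hxd : x ∈ A†.domain := by
        rw [hxe]
        exact Submodule.smul_mem _ _ (resolvent_mem_domain hadj0 x)
      refine mem_ker_subScalar_iff.2 ⟨hxd, ?_⟩
      have hsub : (⟨x, hxd⟩ : A†.domain) =
          μ⁻¹ • ⟨resolvent A† 0 x, resolvent_mem_domain hadj0 x⟩ := Subtype.ext hxe
      rw [hsub, LinearPMap.map_smul, apply_resolvent hadj0, zero_smul, add_zero]
    by_contra hx0
    have hμσ : μ⁻¹ ∈ pointSpectrum A† := fun h => hx0 (by rwa [h, Submodule.mem_bot] at hAx)
    have hmem : x ∈ ker B ⊓ ker (subScalar A† μ⁻¹) := ⟨hBx, hAx⟩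
    rw [hno _ hμσ] at hmem
    exact hx0 ((Submodule.mem_bot ℂ).1 hmem)
  have hNc : IsClosed (N : Set H) := Submodule.isClosed_orthogonal _
  have hperp := Submodule.topologicalClosure_eq_top_iff.1 hg
  rw [Submodule.eq_bot_iff] at hperp ⊢
  refine fun x hx => hperp x ((Submodule.mem_orthogonal' _ _).2 fun y hy => ?_)
  induction hy using Submodule.span_induction with
  | mem y hy =>
    obtain ⟨-, z, -, n, hn⟩ := hy
    exact inner_eq_zero_of_mem_kerPow h0 hinv
      (fun x hx => exists_sub_smul_eq_of_no_eigenvector hK hNc hinv heig _ hx) n y hn x hx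
  | zero => exact inner_zero_right _
  | add y z _ _ hy hz => rw [inner_add_right, hy, hz, add_zero]
  | smul a y _ hy => rw [inner_smul_right, hy, mul_zero]

end UnbddOp

/-- `A` is closed and densely defined with the imaginary axis in its resolvent set, `B` is
symmetric and `D(A*) ⊆ D(B)`; in particular `B` is densely defined, because `D(A*)` is dense.
The first conjunct says that the inverses `(A* + i t)⁻¹` exist as bounded operators. -/
theorem mainTheorem5 {H : Type*} [NormedAddCommGroup H] [InnerProductSpace ℂ H] [CompleteSpace H]
    (A B : H →ₗ.[ℂ] H)
    (hA_closed : A.IsClosed) (hA_dense : Dense (A.domain : Set H))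
    (hA_res : ∀ t : ℝ, Complex.I * t ∈ UnbddOp.resolventSet A)
    (hB_symm : B.IsFormalAdjoint B)
    (hAB : A†.domain ≤ B.domain) :
    (∀ t : ℝ, -(Complex.I * t) ∈ UnbddOp.resolventSet A†) ∧
    (UnbddOp.ker B = ⊥ → UnbddOp.KernelCondition A B) ∧
    (UnbddOp.KernelCondition A B ↔ UnbddOp.DenseSpanCondition A B) ∧
    (UnbddOp.DenseSpanCondition A B → UnbddOp.NoEigenvectorInKernel A B) ∧
    (UnbddOp.HasCompactResolvent A → UnbddOp.HasCompleteGeneralisedEigenvectors A →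
      (UnbddOp.DenseSpanCondition A B ↔ UnbddOp.NoEigenvectorInKernel A B)) := by
  have h0 : Complex.I * (0 : ℝ) ∈ UnbddOp.resolventSet A := hA_res 0
  have hA_adj := UnbddOp.dense_adjoint_domain hA_dense h0
  have hB : Dense (B.domain : Set H) := hA_adj.mono hAB
  -- By symmetry `B*` extends `B`.
  have hB' : Dense (B†.domain : Set H) := hB.mono (hB_symm.le_adjoint hB).1
  have hres' (t : ℝ) : -(Complex.I * t) ∈ UnbddOp.resolventSet A† := by
    rw [← UnbddOp.conj_I_mul]
    exact UnbddOp.conj_mem_resolventSet_adjoint hA_dense (hA_res t)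
  have hiff : UnbddOp.KernelCondition A B ↔ UnbddOp.DenseSpanCondition A B := by
    rw [UnbddOp.denseSpanCondition_iff, UnbddOp.KernelCondition,
      UnbddOp.iInf_ker_compBounded_eq hA_dense hA_res hB hB' hAB]
  have himp : UnbddOp.DenseSpanCondition A B → UnbddOp.NoEigenvectorInKernel A B := by
    refine fun h z _ => (Submodule.eq_bot_iff _).2 fun x hx => ?_
    have hx' : x ∈ ⨅ t : ℝ,
        UnbddOp.ker (UnbddOp.compBounded B (UnbddOp.resolvent A† (-(Complex.I * t)))) :=
      (Submodule.mem_iInf _).2 fun t =>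
        UnbddOp.mem_ker_compBounded_resolvent_of_eigenvector (hres' t) hx
    rw [hiff.2 h] at hx'
    exact (Submodule.mem_bot ℂ).1 hx'
  refine ⟨hres', fun hker => (Submodule.eq_bot_iff _).2 fun x hx => ?_, hiff, himp,
    fun hc hg => ⟨himp, UnbddOp.denseSpanCondition_of_noEigenvectorInKernel hA_dense hA_res hB hB'
      hAB hc hg⟩⟩
  -- The single value `t = 0` suffices.
  have hx0 := UnbddOp.mem_ker_compBounded_iff.1 ((Submodule.mem_iInf _).1 hx 0)
  rw [hker, Submodule.mem_bot] at hx0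
  exact UnbddOp.resolvent_injective (hres' 0) hx0
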